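/- **Setting.** Let $\Sigma=CS\uplus FS$ be a first-order signature of constructor and function symbols with arities, with a distinguished $?\in FS^2$ (written infix), and let $\mathcal V$ be a set of variables. Total expressions ($\mathit{Exp}$) are the terms over $\Sigma$ and $\mathcal V$; partial expressions ($\mathit{Exp}_\bot$) may also contain the constant $\bot$. Total and partial c-terms ($\mathit{CTerm}$, $\mathit{CTerm}_\bot$) are those without function symbols. On $\mathit{Exp}_\bot$, $\sqsubseteq$ is the least partial order with $\bot\sqsubseteq e$ and $e\sqsubseteq e'\Rightarrow C[e]\sqsubseteq C[e']$ for all one-hole contexts $C$. The shell of $e$ is given by $|X|=X$, $|c(e_1,\dots,e_n)|=c(|e_1|,\dots,|e_n|)$ for $c\in CS$, $|f(\dots)|=\bot$ for $f\in FS$, $|\bot|=\bot$. A program $\mathcal P$ is a (possibly infinite) set of rules $f(p_1,\dots,p_n)\to r$ with $f\in FS^n$, $p_i\in \mathit{CTerm}$, no variable occurring twice in $(p_1,\dots,p_n)$, and $r\in \mathit{Exp}$ (which may contain extra variables, i.e. variables not in the left-hand side). For two distinct variables $X,Y$ it contains $X\,?\,Y\to X$ and $X\,?\,Y\to Y$,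 and it has no other rule for $?$. Rewriting is $C[l\sigma]\to C[r\sigma]$ for a context $C$ over $\mathit{Exp}$, $(l\to r)\in\mathcal P$ and a substitution $\sigma:\mathcal V\to \mathit{Exp}$ of finite domain; $\to^*$ is its reflexive-transitive closure. An s-expression is a finite set of elemental s-expressions; an elemental s-expression is a variable or $h(se_1,\dots,se_n)$ with $h\in\Sigma^n$ and s-expressions $se_i$. S-cterms are the s-expressions without function symbols. An s-csubstitution $\theta$ maps variables to s-cterms, with $\theta(X)=\{X\}$ for all but finitely many $X$; it acts by $X\theta=\theta(X)$, $h(se_1,\dots,se_n)\theta=\{h(se_1\theta,\dots,se_n\theta)\}$, $se\,\theta=\bigcup_{a\in se}a\theta$. For $e\in \mathit{Exp}_\bot$ define $\widetilde{\bot}=\emptyset$, $\widetilde X=\{X\}$, $\widetilde{h(e_1,\dots,e_n)}=\{h(\widetilde{e_1},\dots,\widetilde{e_n})\}$. Flattening is $\mathit{flat}(\emptyset)=\{\bot\}$, $\mathit{flat}(se)=\bigcup_{a\in se}\mathit{flat}(a)$ for $se\neq\emptyset$, $\mathit{flat}(X)=\{X\}$, $\mathit{flat}(h(se_1,\dots,se_n))=\{h(e_1,\dots,e_n)\mid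 e_i\in \mathit{flat}(se_i)\}$. The relation $se\rightarrowtail st$ is inductively generated by the rules: - (E) $se\rightarrowtail\emptyset$; - (RR) $\{X\}\rightarrowtail\{X\}$ for $X\in\mathcal V$; - (DC) $\{c(se_1,\dots,se_n)\}\rightarrowtail\{c(st_1,\dots,st_n)\}$ if $c\in CS$ and $se_i\rightarrowtail st_i$ for all $i$; - (More) $se\rightarrowtail st_1\cup\dots\cup st_n$ if $se\rightarrowtail st_i$ for all $i$; - (Less) $se\rightarrowtail st_1\cup\dots\cup st_m$ if $se$ has at least two elements, $m>0$, and there are $a_1,\dots,a_m\in se$ with $\{a_j\}\rightarrowtail st_j$ for all $j$; - (ROR) $\{f(se_1,\dots,se_n)\}\rightarrowtail st$ if, for some rule $(f(p_1,\dots,p_n)\to r)\in\mathcal P$ and some s-csubstitution $\theta$, $se_i\rightarrowtail\widetilde{p_i}\,\theta$ for all $i$ and $\widetilde r\,\theta\rightarrowtail st$. The denotation of $se$ is $[\![se]\!]=\{st\text{ an s-cterm}\mid se\rightarrowtail st\}$. **Theorem (Adequacy of $[\![\_]\!]$).** For every program, all $e,e'\in \mathit{Exp}$, $t\in \mathit{CTerm}_\bot$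 and every s-cterm $st$: *Soundness.* (a) If $st\in[\![\widetilde e]\!]$ and $t\in \mathit{flat}(st)$, then $e\to^* e''$ for some $e''\in \mathit{Exp}$ with $t\sqsubseteq|e''|$. (b) If $\widetilde t\in[\![\widetilde e]\!]$, then $e\to^* e''$ for some $e''\in \mathit{Exp}$ with $t\sqsubseteq|e''|$. (c) In either case, if $t$ is total then $e\to^* t$. *Completeness.* (d) If $e\to^* e'$, then $\widetilde{|e'|}\in[\![\widetilde e]\!]$. (e) If $t$ is total and $e\to^* t$, then $\widetilde t\in[\![\widetilde e]\!]$. -/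

import Mathlib

universe u

noncomputable section

namespace SCalc

/-- A first-order signature `Σ = CS ⊎ FS`, sorted by arity, with the distinguished binary
function symbol `?`. -/
structure Signature where
  /-- constructor symbols of each arity -/
  Con : ℕ → Type u
  /-- defined function symbols of each arity -/
  Fun : ℕ → Type u
  /-- the binary function symbol `?` -/
  choice : Fun 2

/-- The symbols of arity `n`: constructors on the left, function symbols on the right. -/
abbrev Signature.Sym (S : Signature.{u}) (n : ℕ) : Type u := S.Con n ⊕ S.Fun n

/-! ### Expressions -/

/-- Partial expressions over the variables `V`. -/
inductive PExp (S : Signature.{u}) (V : Type u) : Type u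
  | bot : PExp S V
  | var (X : V) : PExp S V
  | app {n : ℕ} (h : S.Sym n) (args : Fin n → PExp S V) : PExp S V

variable {S : Signature.{u}} {V : Type u}

namespace PExp

/-- The partial expressions without `⊥`, that is, the set of (total) expressions. -/
def IsTotal : PExp S V → Prop
  | bot => False
  | var _ => True
  | app _ args => ∀ i, IsTotal (args i)

/-- The partial expressions without function symbols, that is, the set of partial c-terms.
A total c-term is a partial c-term that is total. -/
def IsCTerm : PExp S V → Prop
  | bot => True
  | var _ => True
  | app (.inl _) args => ∀ i, IsCTerm (args i)
  | app (.inr _) _ => False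

/-- The shell `|e|`: the outer constructed part of `e`. -/
def shell : PExp S V → PExp S V
  | bot => bot
  | var X => var X
  | app (.inl c) args => app (.inl c) fun i => shell (args i)
  | app (.inr _) _ => bot

open Classical in
/-- The number of occurrences of the variable `X` in an expression. -/
def occ (X : V) : PExp S V → ℕ
  | bot => 0
  | var Y => if X = Y then 1 else 0
  | app _ args => ∑ i, occ X (args i)

/-- Application of a mapping from variables to expressions. -/
def subst (σ : V → PExp S V) : PExp S V → PExp S V
  | bot => bot
  | var X => σ X
  | app h args => app h fun i => subst σ (args i)

end PExp

/-- One-hole contexts `C ::= [ ] | h(e₁, …, C, …, eₙ)`. In `app h i es C` the context `C` is the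
`i`-th argument of `h`, and `es j` is the `j`-th one for `j ≠ i` (the value `es i` is ignored). -/
inductive Ctx (S : Signature.{u}) (V : Type u) : Type u
  | hole : Ctx S V
  | app {n : ℕ} (h : S.Sym n) (i : Fin n) (es : Fin n → PExp S V) (C : Ctx S V) : Ctx S V

/-- `C[e]`. -/
def Ctx.fill : Ctx S V → PExp S V → PExp S V
  | hole, e => e
  | app h i es C, e => .app h (Function.update es i (C.fill e))

/-- The contexts in which `⊥` does not occur. -/
def Ctx.IsTotal : Ctx S V → Prop
  | hole => True
  | app _ i es C => (∀ j, j ≠ i → (es j).IsTotal) ∧ C.IsTotal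

/-- The approximation ordering on partial expressions: the least reflexive and transitive relation
with `⊥ ⊑ e` that is closed under contexts. It is antisymmetric (`Approx.antisymm`), so it is also the least
partial order with these properties. -/
inductive Approx : PExp S V → PExp S V → Prop
  | refl (e : PExp S V) : Approx e e
  | trans {e₁ e₂ e₃ : PExp S V} : Approx e₁ e₂ → Approx e₂ e₃ → Approx e₁ e₃
  | bot (e : PExp S V) : Approx .bot e
  | ctx {e e' : PExp S V} (C : Ctx S V) : Approx e e' → Approx (C.fill e) (C.fill e')

/-- The number of nodes other than `⊥`, used only to see that `⊑` is antisymmetric. -/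
def PExp.weight : PExp S V → ℕ
  | bot => 0
  | var _ => 1
  | app _ args => 1 + ∑ i, weight (args i)

theorem Approx.weight_le {a b : PExp S V} (h : Approx a b) :
    a.weight ≤ b.weight ∧ (a.weight = b.weight → a = b) := by
  induction h with
  | refl e => exact ⟨le_rfl, fun _ => rfl⟩
  | trans _ _ ih₁ ih₂ =>
    refine ⟨ih₁.1.trans ih₂.1, fun h => ?_⟩
    have h₁ := ih₁.1
    have h₂ := ih₂.1
    exact (ih₁.2 (by omega)).trans (ih₂.2 (by omega))
  | bot e =>
    refine ⟨Nat.zero_le _, fun h => ?_⟩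
    cases e with
    | bot => rfl
    | var X => simp [PExp.weight] at h
    | app f args => simp only [PExp.weight] at h; omega
  | @ctx e e' C _ ih =>
    induction C with
    | hole => exact ih
    | app f i es C ihC =>
      have key : ∀ x : PExp S V, (PExp.app f (Function.update es i x)).weight =
          1 + (x.weight + ∑ j ∈ Finset.univ \ {i}, (es j).weight) := by
        intro x
        have h := Finset.sum_update_of_mem (Finset.mem_univ i) (fun j => (es j).weight) x.weight
        rw [← h]
        simp only [PExp.weight]
        congr 1
        refine Finset.sum_congr rfl fun j _ => ?_
        by_cases hj : j = i
        · subst hj; simp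
        · simp [hj]
      simp only [Ctx.fill, key]
      have h₁ := ihC.1
      refine ⟨by omega, fun h => ?_⟩
      rw [ihC.2 (by omega)]

theorem Approx.antisymm {a b : PExp S V} (h₁ : Approx a b) (h₂ : Approx b a) : a = b :=
  h₁.weight_le.2 (le_antisymm h₁.weight_le.1 h₂.weight_le.1)

/-- Substitutions: finite mappings from variables to total expressions. -/
structure Subst (S : Signature.{u}) (V : Type u) where
  toFun : V → PExp S V
  total : ∀ X, (toFun X).IsTotal
  finite_dom : {X | toFun X ≠ .var X}.Finite

/-! ### Programs and term rewriting -/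

/-- A rewrite rule `f(p₁, …, pₙ) → r`. -/
structure Rule (S : Signature.{u}) (V : Type u) where
  arity : ℕ
  head : S.Fun arity
  pats : Fin arity → PExp S V
  rhs : PExp S V

/-- The left-hand side of a rule. -/
def Rule.lhs (R : Rule S V) : PExp S V := .app (.inr R.head) R.pats

/-- `R` is a left-linear constructor-based rule: its patterns are total c-terms, no variable has
two occurrences in the tuple of patterns, and its right-hand side is a total expression, which may
contain extra variables. -/
structure Rule.IsCRule (R : Rule S V) : Prop where
  pats_cterm : ∀ i, (R.pats i).IsCTerm
  pats_total : ∀ i, (R.pats i).IsTotal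
  linear : ∀ X, ∑ i, (R.pats i).occ X ≤ 1
  rhs_total : R.rhs.IsTotal

/-- The rule `X ? Y → Z`. -/
def choiceRule (X Y Z : V) : Rule S V where
  arity := 2
  head := S.choice
  pats := ![.var X, .var Y]
  rhs := .var Z

/-- Programs: (possibly infinite) sets of left-linear constructor-based rules that contain
`X ? Y → X` and `X ? Y → Y` and no other rule for `?`. -/
structure Program (S : Signature.{u}) (V : Type u) where
  rules : Set (Rule S V)
  isCRule : ∀ R ∈ rules, R.IsCRule
  choice_rules : ∃ X Y : V, X ≠ Y ∧
    {R ∈ rules | (⟨R.arity, R.head⟩ : Σ n, S.Fun n) = ⟨2, S.choice⟩} =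
      {choiceRule X Y X, choiceRule X Y Y}

/-- One rewriting step `C[lσ] → C[rσ]`. -/
def Step (P : Program S V) (e e' : PExp S V) : Prop :=
  ∃ (C : Ctx S V) (R : Rule S V) (σ : Subst S V), C.IsTotal ∧ R ∈ P.rules ∧
    e = C.fill (R.lhs.subst σ.toFun) ∧ e' = C.fill (R.rhs.subst σ.toFun)

/-- The reflexive and transitive closure of the rewriting relation. -/
def Rewrites (P : Program S V) : PExp S V → PExp S V → Prop :=
  Relation.ReflTransGen (Step P)

/-! ### S-expressions

Elemental s-expressions are `X` or `h(se₁, …, seₙ)` with finite sets `seᵢ` of elemental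
s-expressions, so they form the initial algebra of `α ↦ V + Σ n, Symₙ × (Finset α)ⁿ`. -/

/-- The shapes of elemental s-expressions whose arguments are finite sets of elements of `α`. -/
def Shape (S : Signature.{u}) (V : Type u) (α : Type u) : Type u :=
  V ⊕ Σ n : ℕ, S.Sym n × (Fin n → Finset α)

open Classical in
instance : Functor (Shape S V) where
  map f
    | .inl X => .inl X
    | .inr ⟨n, h, args⟩ => .inr ⟨n, h, fun i => (args i).image f⟩

open Classical in
/-- A finite set is represented by an enumeration of its elements. -/
instance : QPF (Shape S V) where
  P :=
    { A := V ⊕ Σ n : ℕ, S.Sym n × (Fin n → ℕ)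
      B := fun
        | .inl _ => ULift.{u} Empty
        | .inr ⟨n, _, k⟩ => ULift.{u} (Σ i : Fin n, Fin (k i)) }
  abs
    | ⟨.inl X, _⟩ => .inl X
    | ⟨.inr ⟨n, h, _⟩, f⟩ =>
      .inr ⟨n, h, fun i => Finset.univ.image fun j => f (ULift.up ⟨i, j⟩)⟩
  repr
    | .inl X => ⟨.inl X, fun x => x.down.elim⟩
    | .inr ⟨n, h, args⟩ =>
      ⟨.inr ⟨n, h, fun i => (args i).card⟩,
        fun x => ((args x.down.1).equivFin.symm x.down.2 : _)⟩
  abs_repr := by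
    rintro α (X | ⟨n, h, args⟩)
    · rfl
    · refine congrArg Sum.inr ?_
      refine Sigma.ext rfl (heq_of_eq (Prod.ext rfl ?_))
      funext i
      ext a
      simp only [Finset.mem_image, Finset.mem_univ, true_and]
      constructor
      · rintro ⟨j, rfl⟩
        exact ((args i).equivFin.symm j).2
      · intro ha
        exact ⟨(args i).equivFin ⟨a, ha⟩, by simp⟩
  abs_map := by
    rintro α β f ⟨X | ⟨n, h, k⟩, g⟩
    · rfl
    · refine congrArg Sum.inr ?_
      refine Sigma.ext rfl (heq_of_eq (Prod.ext rfl ?_))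
      funext i
      ext a
      simp

/-- Elemental s-expressions. -/
def ESExp (S : Signature.{u}) (V : Type u) : Type u := QPF.Fix (Shape S V)

/-- S-expressions: finite sets of elemental s-expressions. -/
abbrev SExp (S : Signature.{u}) (V : Type u) : Type u := Finset (ESExp S V)

instance : DecidableEq (ESExp S V) := Classical.decEq _

namespace ESExp

/-- The elemental s-expression `X`. -/
def var (X : V) : ESExp S V := QPF.Fix.mk (F := Shape S V) (.inl X)

/-- The elemental s-expression `h(se₁, …, seₙ)`. -/
def app {n : ℕ} (h : S.Sym n) (args : Fin n → SExp S V) : ESExp S V :=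
  QPF.Fix.mk (F := Shape S V) (.inr ⟨n, h, args⟩)

/-- Structural recursion on elemental s-expressions. -/
def fold {α : Type u} (v : V → α) (a : ∀ n : ℕ, S.Sym n → (Fin n → Finset α) → α) :
    ESExp S V → α :=
  QPF.Fix.rec (F := Shape S V) fun
    | .inl X => v X
    | .inr ⟨n, h, args⟩ => a n h args

theorem fold_var {α : Type u} (v : V → α) (a : ∀ n : ℕ, S.Sym n → (Fin n → Finset α) → α) (X : V) :
    fold v a (var X) = v X :=
  QPF.Fix.rec_eq (F := Shape S V) _ _

open Classical in
theorem fold_app {α : Type u} (v : V → α) (a : ∀ n : ℕ, S.Sym n → (Fin n → Finset α) → α)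
    {n : ℕ} (h : S.Sym n) (args : Fin n → SExp S V) :
    fold v a (app h args) = a n h fun i => (args i).image (fold v a) :=
  QPF.Fix.rec_eq (F := Shape S V) _ _

theorem mk_injective : Function.Injective (QPF.Fix.mk (F := Shape S V)) := fun x y h =>
  (QPF.Fix.dest_mk x).symm.trans ((congrArg QPF.Fix.dest h).trans (QPF.Fix.dest_mk y))

theorem var_injective : Function.Injective (var : V → ESExp S V) := fun _ _ h =>
  Sum.inl.inj (mk_injective h)

theorem app_inj {n : ℕ} {h h' : S.Sym n} {args args' : Fin n → SExp S V}
    (H : app h args = app h' args') : h = h' ∧ args = args' :=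
  Prod.mk.inj (eq_of_heq (Sigma.mk.inj (Sum.inr.inj (mk_injective H))).2)

theorem app_inj_arity {n m : ℕ} {h : S.Sym n} {h' : S.Sym m} {args : Fin n → SExp S V}
    {args' : Fin m → SExp S V} (H : app h args = app h' args') : n = m :=
  congrArg Sigma.fst (Sum.inr.inj (mk_injective H))

theorem var_ne_app (X : V) {n : ℕ} (h : S.Sym n) (args : Fin n → SExp S V) :
    var X ≠ app h args := fun H =>
  Sum.inl_ne_inr (mk_injective H)

open Classical in
theorem induction {p : ESExp S V → Prop} (hvar : ∀ X, p (var X))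
    (happ : ∀ {n : ℕ} (h : S.Sym n) (args : Fin n → SExp S V),
      (∀ i, ∀ e ∈ args i, p e) → p (app h args)) (e : ESExp S V) : p e := by
  refine QPF.Fix.ind (F := Shape S V) p ?_ e
  rintro (X | ⟨n, h, args⟩) hx
  · exact hvar X
  · refine happ h args fun i e he => ?_
    obtain ⟨u, hu⟩ := hx
    rcases u with X | ⟨m, h', args'⟩
    · exact absurd hu Sum.inl_ne_inr
    · have h1 := Sum.inr.inj hu
      obtain rfl : m = n := congrArg Sigma.fst h1
      have h2 := congrArg Prod.snd (eq_of_heq (Sigma.mk.inj h1).2)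
      have h3 : (args' i).image Subtype.val = args i := congrFun h2 i
      have he' : e ∈ (args' i).image Subtype.val := h3 ▸ he
      obtain ⟨y, -, rfl⟩ := Finset.mem_image.1 he'
      exact y.2

/-- The elemental s-cterms: no function symbol occurs. -/
inductive IsESCTerm : ESExp S V → Prop
  | var (X : V) : IsESCTerm (var X)
  | con {n : ℕ} (c : S.Con n) (args : Fin n → SExp S V) :
      (∀ i, ∀ e ∈ args i, IsESCTerm e) → IsESCTerm (app (.inl c) args)

/-- Application of a mapping from variables to s-expressions:
`Xσ = σ(X)` and `h(se₁, …, seₙ)σ = {h(se₁σ, …, seₙσ)}`. -/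
def subst (σ : V → SExp S V) : ESExp S V → SExp S V :=
  fold σ fun _ h args => {app h fun i => (args i).biUnion id}

end ESExp

namespace SExp

/-- The s-cterms: finite sets of elemental s-cterms. -/
def IsSCTerm (st : SExp S V) : Prop := ∀ e ∈ st, ESExp.IsESCTerm e

/-- `se σ` is the union of the `ese σ` with `ese ∈ se`. -/
def subst (σ : V → SExp S V) (se : SExp S V) : SExp S V := se.biUnion (ESExp.subst σ)

end SExp

theorem ESExp.subst_var (σ : V → SExp S V) (X : V) : ESExp.subst σ (ESExp.var X) = σ X :=
  ESExp.fold_var _ _ X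

theorem ESExp.subst_app (σ : V → SExp S V) {n : ℕ} (h : S.Sym n) (args : Fin n → SExp S V) :
    ESExp.subst σ (ESExp.app h args) = {ESExp.app h fun i => SExp.subst σ (args i)} := by
  refine (ESExp.fold_app _ _ h args).trans ?_
  refine congrArg (fun x => ({ESExp.app h x} : SExp S V)) (funext fun i => ?_)
  ext a
  simp [SExp.subst, ESExp.subst]

/-- The s-expression of a partial expression. -/
def PExp.toSExp : PExp S V → SExp S V
  | bot => ∅
  | var X => {ESExp.var X}
  | app h args => {ESExp.app h fun i => toSExp (args i)}

/-- `flat(se)` for a finite set `se` whose elements have the flattenings in `F`: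
`flat(∅) = {⊥}`, and otherwise the union of the flattenings of the elements. -/
def flatUnion (F : Set (Set (PExp S V))) : Set (PExp S V) :=
  {e | (F = ∅ ∧ e = .bot) ∨ ∃ A ∈ F, e ∈ A}

/-- Flattening of elemental s-expressions: `flat(X) = {X}` and
`flat(h(se₁, …, seₙ)) = {h(e₁, …, eₙ) | eᵢ ∈ flat(seᵢ)}`. -/
def ESExp.flat : ESExp S V → Set (PExp S V) :=
  fold (fun X => {.var X})
    fun _ h args => {e | ∃ es, e = .app h es ∧ ∀ i, es i ∈ flatUnion (args i : Set _)}

/-- Flattening of s-expressions. -/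
def SExp.flat (se : SExp S V) : Set (PExp S V) := flatUnion (ESExp.flat '' (se : Set _))

theorem ESExp.flat_var (X : V) : (ESExp.var X : ESExp S V).flat = {.var X} :=
  ESExp.fold_var _ _ X

theorem ESExp.flat_app {n : ℕ} (h : S.Sym n) (args : Fin n → SExp S V) :
    (ESExp.app h args).flat = {e | ∃ es, e = .app h es ∧ ∀ i, es i ∈ (args i).flat} := by
  refine (ESExp.fold_app _ _ h args).trans ?_
  simp only [Finset.coe_image]
  rfl

theorem SExp.flat_empty : (∅ : SExp S V).flat = {.bot} := by
  ext e
  simp [SExp.flat, flatUnion]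

theorem SExp.flat_of_nonempty {se : SExp S V} (h : se.Nonempty) :
    se.flat = ⋃ e ∈ se, e.flat := by
  ext e
  simp [SExp.flat, flatUnion, h.ne_empty]

/-- S-csubstitutions: finite mappings from variables to s-cterms (possibly `∅`). -/
structure SCSubst (S : Signature.{u}) (V : Type u) where
  toFun : V → SExp S V
  isSCTerm : ∀ X, (toFun X).IsSCTerm
  finite_dom : {X | toFun X ≠ {ESExp.var X}}.Finite

/-! ### The proof calculus -/

/-- `Derives P se st` means that `se → st` is derivable in the calculus under the program `P`. -/
inductive Derives (P : Program S V) : SExp S V → SExp S V → Prop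
  | E (se : SExp S V) : Derives P se ∅
  | RR (X : V) : Derives P {ESExp.var X} {ESExp.var X}
  | DC {n : ℕ} (c : S.Con n) (se st : Fin n → SExp S V) :
      (∀ i, Derives P (se i) (st i)) →
      Derives P {ESExp.app (.inl c) se} {ESExp.app (.inl c) st}
  | More {n : ℕ} (se : SExp S V) (st : Fin n → SExp S V) :
      (∀ i, Derives P se (st i)) → Derives P se (Finset.univ.biUnion st)
  | Less {m : ℕ} (se : SExp S V) (esa : Fin m → ESExp S V) (st : Fin m → SExp S V) :
      2 ≤ se.card → 0 < m → (∀ j, esa j ∈ se) → (∀ j, Derives P {esa j} (st j)) →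
      Derives P se (Finset.univ.biUnion st)
  | ROR (R : Rule S V) (θ : SCSubst S V) (se : Fin R.arity → SExp S V) (st : SExp S V) :
      R ∈ P.rules → (∀ i, Derives P (se i) ((R.pats i).toSExp.subst θ.toFun)) →
      Derives P (R.rhs.toSExp.subst θ.toFun) st →
      Derives P {ESExp.app (.inr R.head) se} st

/-- The denotation of an s-expression: the set of the s-cterms `st` with `se → st`. -/
def den (P : Program S V) (se : SExp S V) : Set (SExp S V) :=
  {st | st.IsSCTerm ∧ Derives P se st}

end SCalc

end

open SCalc

namespace SCalc

variable {S : Signature.{u}} {V : Type u} {P : Program S V}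

/-! The calculus manipulates finite sets of alternatives, while rewriting picks one alternative at a
time; the two are related as follows.

*Soundness.* Call an expression `e` a cover of an s-expression if every alternative in it, at every
depth, can be reached from `e` by rewriting. Each `e` covers `e.toSExp`, and covering is preserved
along derivations. For (ROR), the patterns are matched against the covering arguments, where
left-linearity lets the matches be glued into one substitution; an extra variable is sent to an
expression that joins all the alternatives in its value by `?`. Finally, rewriting a cover of an
s-cterm inside its constructor part yields any element of its flattening.

*Completeness.* If `e` rewrites to `e'`, then everything derivable from `e'.toSExp` is derivable
from `e.toSExp`; now use that `e'.toSExp` derives the shell of `e'`. For a rewriting step with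
substitution `σ`, a derivation from an instance under `σ` uses only finitely many s-cterms derived
from each `σ X`, and their unions form the s-csubstitution with which (ROR) is applied. -/

/-! ### Expressions -/

theorem rel_of_forall_rel_update {ι α : Type*} [Finite ι] [DecidableEq ι]
    {r : (ι → α) → (ι → α) → Prop} (refl : ∀ u, r u u)
    (trans : ∀ {u v w}, r u v → r v w → r u w) {f g : ι → α}
    (update : ∀ u i, (∀ j, u j = f j ∨ u j = g j) → u i = f i →
      r u (Function.update u i (g i))) : r f g := by
  have := Fintype.ofFinite ι
  suffices ∀ s : Finset ι, r f (s.piecewise g f) by simpa using this Finset.univ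
  intro s
  induction s using Finset.induction_on with
  | empty => simpa using refl f
  | insert i s hi ih =>
    rw [Finset.piecewise_insert]
    refine trans ih (update _ i (fun j => ?_) (Finset.piecewise_eq_of_notMem _ _ _ hi))
    exact (em (j ∈ s)).symm.imp (Finset.piecewise_eq_of_notMem _ _ _)
      (Finset.piecewise_eq_of_mem _ _ _)

theorem Ctx.isTotal_fill {C : Ctx S V} {e : PExp S V} :
    (C.fill e).IsTotal ↔ C.IsTotal ∧ e.IsTotal := by
  induction C with
  | hole => simp only [fill, IsTotal, true_and]
  | app h i es C ih =>
    simp only [fill, PExp.IsTotal, IsTotal, Function.forall_update_iff, ih]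
    tauto

theorem PExp.IsTotal.subst {e : PExp S V} (he : e.IsTotal) (σ : Subst S V) :
    (e.subst σ.toFun).IsTotal := by
  induction e with
  | bot => exact he
  | var X => exact σ.total X
  | app h args ih => exact fun i => ih i (he i)

theorem Approx.app {n : ℕ} (h : S.Sym n) {es es' : Fin n → PExp S V}
    (H : ∀ i, Approx (es i) (es' i)) : Approx (.app h es) (.app h es') := by
  refine rel_of_forall_rel_update (r := fun u v => Approx (.app h u) (.app h v)) (fun _ => .refl _)
    .trans fun u i _ hi => ?_
  simpa [Ctx.fill, ← hi] using Approx.ctx (.app h i u .hole) (H i)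

theorem Approx.eq_of_isTotal {a b : PExp S V} (h : Approx a b) (ha : a.IsTotal) : a = b := by
  induction h with
  | refl => rfl
  | trans _ _ ih₁ ih₂ =>
    obtain rfl := ih₁ ha
    exact ih₂ ha
  | bot => exact ha.elim
  | ctx C _ ih => rw [ih (Ctx.isTotal_fill.1 ha).2]

theorem PExp.shell_eq_of_isTotal_shell {e : PExp S V} (h : e.shell.IsTotal) : e.shell = e := by
  induction e with
  | bot | var => rfl
  | app f args ih =>
    rcases f with c | f
    · exact congrArg _ (funext fun i => ih i (h i))
    · exact h.elim

theorem Approx.eq_of_isTotal_of_shell {t e : PExp S V} (h : Approx t e.shell) (ht : t.IsTotal) :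
    t = e := by
  have h_eq := h.eq_of_isTotal ht
  exact h_eq.trans (PExp.shell_eq_of_isTotal_shell (h_eq ▸ ht))

theorem PExp.IsCTerm.shell_eq {e : PExp S V} (h : e.IsCTerm) : e.shell = e := by
  induction e with
  | bot | var => rfl
  | app f args ih =>
    rcases f with c | f
    · exact congrArg _ (funext fun i => ih i (h i))
    · exact h.elim

/-- The set of the variables that occur in an expression. -/
def PExp.vars (e : PExp S V) : Set V := {X | e.occ X ≠ 0}

theorem PExp.mem_vars_var (X : V) : X ∈ (PExp.var X : PExp S V).vars := by
  simp [vars, occ]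

theorem PExp.mem_vars_app {n : ℕ} {h : S.Sym n} {args : Fin n → PExp S V} {X : V} :
    X ∈ (PExp.app h args).vars ↔ ∃ i, X ∈ (args i).vars := by
  simp [vars, occ]

theorem PExp.subst_congr {σ τ : V → PExp S V} {e : PExp S V} (h : Set.EqOn σ τ e.vars) :
    e.subst σ = e.subst τ := by
  induction e with
  | bot => rfl
  | var X => exact h (mem_vars_var X)
  | app f args ih =>
    exact congrArg _ (funext fun i => ih i fun X hX => h (mem_vars_app.2 ⟨i, hX⟩))

/-- Linear expressions: no variable occurs twice. A rule is left-linear if its left-hand side is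
linear. -/
def PExp.IsLinear (e : PExp S V) : Prop := ∀ X, e.occ X ≤ 1

theorem PExp.IsLinear.arg {n : ℕ} {h : S.Sym n} {args : Fin n → PExp S V}
    (hlin : (PExp.app h args).IsLinear) (i : Fin n) : (args i).IsLinear := fun X =>
  (Finset.single_le_sum (f := fun i => (args i).occ X) (fun _ _ => Nat.zero_le _)
    (Finset.mem_univ i)).trans (hlin X)

theorem PExp.IsLinear.eq_of_mem_vars {n : ℕ} {h : S.Sym n} {args : Fin n → PExp S V}
    (hlin : (PExp.app h args).IsLinear) {X : V} {i j : Fin n} (hi : X ∈ (args i).vars)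
    (hj : X ∈ (args j).vars) : i = j := by
  by_contra hne
  have hle : ∑ k ∈ {i, j}, (args k).occ X ≤ 1 :=
    (Finset.sum_le_sum_of_subset (Finset.subset_univ _)).trans (hlin X)
  rw [Finset.sum_pair hne] at hle
  simp only [vars, Set.mem_ofPred_eq] at hi hj
  omega

/-! ### S-expressions -/

theorem PExp.toSExp_var_subst (θ : V → SExp S V) (X : V) :
    (PExp.var X : PExp S V).toSExp.subst θ = θ X := by
  simp [toSExp, SExp.subst, ESExp.subst_var]

theorem PExp.toSExp_app_subst (θ : V → SExp S V) {n : ℕ} (h : S.Sym n) (args : Fin n → PExp S V) :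
    (PExp.app h args).toSExp.subst θ = {ESExp.app h fun i => (args i).toSExp.subst θ} := by
  simp [toSExp, SExp.subst, ESExp.subst_app]

theorem PExp.toSExp_subst (σ : V → PExp S V) (e : PExp S V) :
    (e.subst σ).toSExp = e.toSExp.subst fun X => (σ X).toSExp := by
  induction e with
  | bot => rfl
  | var X => rw [toSExp_var_subst, subst]
  | app h args ih => rw [toSExp_app_subst, subst, toSExp, funext ih]

theorem PExp.mem_flat_toSExp (e : PExp S V) : e ∈ e.toSExp.flat := by
  induction e with
  | bot => simp [toSExp, SExp.flat_empty]
  | var X => simp [toSExp, SExp.flat_of_nonempty, ESExp.flat_var]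
  | app h args ih =>
    simpa [toSExp, SExp.flat_of_nonempty, ESExp.flat_app] using ih

theorem SExp.isSCTerm_singleton {a : ESExp S V} :
    IsSCTerm ({a} : SExp S V) ↔ a.IsESCTerm := by
  simp [IsSCTerm]

theorem SExp.IsSCTerm.biUnion {ι : Type*} {s : Finset ι} {st : ι → SExp S V}
    (h : ∀ i ∈ s, (st i).IsSCTerm) : SExp.IsSCTerm (s.biUnion st) := by
  intro a ha
  obtain ⟨i, hi, ha⟩ := Finset.mem_biUnion.1 ha
  exact h i hi a ha

/-! ### Substitutions -/

open Classical in
/-- The substitution `σ`, except that it maps `X` to the total expression `e`. -/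
noncomputable def Subst.update (σ : Subst S V) (X : V) {e : PExp S V} (he : e.IsTotal) :
    Subst S V where
  toFun := Function.update σ.toFun X e
  total := Function.forall_update_iff _ (fun _ (e : PExp S V) => e.IsTotal) |>.2
    ⟨he, fun Y _ => σ.total Y⟩
  finite_dom := by
    refine (σ.finite_dom.insert X).subset fun Y hY => or_iff_not_imp_left.2 fun hne => ?_
    simpa [Function.update_of_ne hne] using hY

theorem Subst.update_self (σ : Subst S V) (X : V) {e : PExp S V} (he : e.IsTotal) :
    (σ.update X he).toFun X = e := by
  simp [update]

/-- The substitution that follows `σ (κ X)` on each variable `X`, used to glue the members of the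
finite family `σ` together. -/
def Subst.glue {ι : Type*} [Finite ι] (σ : ι → Subst S V) (κ : V → ι) : Subst S V where
  toFun X := (σ (κ X)).toFun X
  total X := (σ (κ X)).total X
  finite_dom := (Set.finite_iUnion fun i => (σ i).finite_dom).subset fun X hX =>
    Set.mem_iUnion.2 ⟨κ X, hX⟩

/-! ### Rewriting -/

theorem Step.isTotal {e e' : PExp S V} (h : Step P e e') : e'.IsTotal := by
  obtain ⟨C, R, σ, hC, hR, -, rfl⟩ := h
  exact Ctx.isTotal_fill.2 ⟨hC, (P.isCRule R hR).rhs_total.subst σ⟩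

theorem Rewrites.isTotal {e e' : PExp S V} (h : Rewrites P e e') (he : e.IsTotal) :
    e'.IsTotal := by
  cases h with
  | refl => exact he
  | tail _ h => exact h.isTotal

theorem Rewrites.app_update {n : ℕ} (h : S.Sym n) {es : Fin n → PExp S V}
    (hes : ∀ j, (es j).IsTotal) (i : Fin n) {a b : PExp S V} (H : Rewrites P a b) :
    Rewrites P (.app h (Function.update es i a)) (.app h (Function.update es i b)) := by
  refine Relation.ReflTransGen.lift (fun a => PExp.app h (Function.update es i a)) ?_ _ _ H
  rintro _ _ ⟨C, R, σ, hC, hR, rfl, rfl⟩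
  exact ⟨.app h i es C, R, σ, ⟨fun j _ => hes j, hC⟩, hR, rfl, rfl⟩

theorem Rewrites.app {n : ℕ} (h : S.Sym n) {es es' : Fin n → PExp S V}
    (hes : ∀ i, (es i).IsTotal) (H : ∀ i, Rewrites P (es i) (es' i)) :
    Rewrites P (.app h es) (.app h es') := by
  refine rel_of_forall_rel_update (r := fun u v => Rewrites P (.app h u) (.app h v))
    (fun _ => .refl) .trans fun u i hu hi => ?_
  have hu_total : ∀ j, (u j).IsTotal := fun j => by
    rcases hu j with hj | hj
    · exact hj ▸ hes j
    · exact hj ▸ (H j).isTotal (hes j)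
  simpa [← hi] using Rewrites.app_update h hu_total i (H i)

theorem Rewrites.of_rule {R : Rule S V} (hR : R ∈ P.rules) (σ : Subst S V) :
    Rewrites P (R.lhs.subst σ.toFun) (R.rhs.subst σ.toFun) :=
  .single ⟨.hole, R, σ, trivial, hR, rfl, rfl⟩

theorem Rewrites.choice (P : Program S V) {e₁ e₂ : PExp S V} (h₁ : e₁.IsTotal) (h₂ : e₂.IsTotal) :
    Rewrites P (.app (.inr S.choice) ![e₁, e₂]) e₁ ∧
      Rewrites P (.app (.inr S.choice) ![e₁, e₂]) e₂ := by
  obtain ⟨X, Y, hXY, hP⟩ := P.choice_rules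
  let σ : Subst S V := (Subst.update ⟨.var, fun _ => trivial, by simp⟩ X h₁).update Y h₂
  have hσX : σ.toFun X = e₁ := by simp [σ, Subst.update, hXY]
  have hσY : σ.toFun Y = e₂ := Subst.update_self _ _ _
  have rewrites_rule : ∀ Z, choiceRule X Y Z ∈ P.rules →
      Rewrites P (.app (.inr S.choice) ![e₁, e₂]) (σ.toFun Z) := fun Z hZ => by
    have hargs : (fun i => PExp.subst σ.toFun (![.var X, .var Y] i)) = ![e₁, e₂] := by
      ext i
      fin_cases i
      exacts [hσX, hσY]
    exact hargs ▸ Rewrites.of_rule hZ σ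
  exact ⟨hσX ▸ rewrites_rule X (hP.ge (.inl rfl)).1, hσY ▸ rewrites_rule Y (hP.ge (.inr rfl)).1⟩

/-! ### Soundness -/

/-- `e` covers the elemental s-expression `a`: it rewrites to an expression with the root of `a`
whose arguments cover all the elements of the corresponding arguments of `a`. This is the invariant
of the soundness proof. -/
inductive CoversElem (P : Program S V) : PExp S V → ESExp S V → Prop
  | var {e : PExp S V} (X : V) : Rewrites P e (.var X) → CoversElem P e (.var X)
  | app {e : PExp S V} {n : ℕ} (h : S.Sym n) (es : Fin n → PExp S V) (args : Fin n → SExp S V) :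
      Rewrites P e (.app h es) → (∀ i, ∀ a ∈ args i, CoversElem P (es i) a) →
      CoversElem P e (.app h args)

/-- `e` covers the s-expression `se`: it covers all the elements of `se`. -/
def Covers (P : Program S V) (e : PExp S V) (se : SExp S V) : Prop := ∀ a ∈ se, CoversElem P e a

/-- `σ` covers `θ`: it covers it pointwise. -/
def Subst.Covers (P : Program S V) (σ : Subst S V) (θ : V → SExp S V) : Prop :=
  ∀ X, SCalc.Covers P (σ.toFun X) (θ X)

theorem coversElem_var {e : PExp S V} {X : V} :
    CoversElem P e (.var X) ↔ Rewrites P e (.var X) := by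
  refine ⟨fun H => ?_, .var X⟩
  generalize ha : ESExp.var X = a at H
  cases H with
  | var Y h => exact ESExp.var_injective ha ▸ h
  | app => exact absurd ha (ESExp.var_ne_app _ _ _)

theorem coversElem_app {e : PExp S V} {n : ℕ} {h : S.Sym n} {args : Fin n → SExp S V} :
    CoversElem P e (.app h args) ↔
      ∃ es, Rewrites P e (.app h es) ∧ ∀ i, Covers P (es i) (args i) := by
  refine ⟨fun H => ?_, fun ⟨es, hes, hargs⟩ => .app h es args hes hargs⟩
  generalize ha : ESExp.app h args = a at H
  cases H with
  | var => exact absurd ha.symm (ESExp.var_ne_app _ _ _)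
  | app _ es _ hes hargs =>
    obtain rfl := ESExp.app_inj_arity ha
    obtain ⟨rfl, rfl⟩ := ESExp.app_inj ha
    exact ⟨es, hes, hargs⟩

theorem covers_singleton {e : PExp S V} {a : ESExp S V} :
    Covers P e {a} ↔ CoversElem P e a := by
  simp [Covers]

theorem covers_biUnion {ι : Type*} {s : Finset ι} {se : ι → SExp S V} {e : PExp S V} :
    Covers P e (s.biUnion se) ↔ ∀ i ∈ s, Covers P e (se i) := by
  simp only [Covers, Finset.mem_biUnion, forall_exists_index, and_imp]
  exact ⟨fun H i hi a ha => H a i hi ha, fun H a i hi ha => H i hi a ha⟩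

theorem CoversElem.of_rewrites {e e' : PExp S V} {a : ESExp S V} (H : CoversElem P e' a)
    (h : Rewrites P e e') : CoversElem P e a := by
  cases H with
  | var X h' => exact .var X (h.trans h')
  | app f es args h' hargs => exact .app f es args (h.trans h') hargs

theorem Covers.of_rewrites {e e' : PExp S V} {se : SExp S V} (H : Covers P e' se)
    (h : Rewrites P e e') : Covers P e se := fun a ha => (H a ha).of_rewrites h

theorem Subst.Covers.update {σ : Subst S V} {θ : V → SExp S V} (H : σ.Covers P θ) {X : V}
    {e : PExp S V} (he : e.IsTotal) (h : SCalc.Covers P e (θ X)) :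
    (σ.update X he).Covers P θ := by
  classical
  exact (Function.forall_update_iff σ.toFun fun Y e => SCalc.Covers P e (θ Y)).2
    ⟨h, fun Y _ => H Y⟩

theorem Subst.Covers.subst {σ : Subst S V} {θ : V → SExp S V} (H : σ.Covers P θ) (e : PExp S V) :
    SCalc.Covers P (e.subst σ.toFun) (e.toSExp.subst θ) := by
  induction e with
  | bot => exact fun a ha => absurd ha (Finset.notMem_empty a)
  | var X =>
    rw [PExp.toSExp_var_subst]
    exact H X
  | app h args ih =>
    rw [PExp.toSExp_app_subst, covers_singleton]
    exact coversElem_app.2 ⟨_, .refl, ih⟩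

theorem covers_toSExp (e : PExp S V) : Covers P e e.toSExp := by
  induction e with
  | bot => exact fun a ha => absurd ha (Finset.notMem_empty a)
  | var X => exact covers_singleton.2 (.var X .refl)
  | app h args ih => exact covers_singleton.2 (.app h args _ .refl ih)

theorem exists_isTotal_covers_of_forall_mem {se : SExp S V}
    (h : ∀ a ∈ se, ∃ e : PExp S V, e.IsTotal ∧ CoversElem P e a) :
    ∃ e : PExp S V, e.IsTotal ∧ Covers P e se := by
  induction se using Finset.induction_on with
  | empty =>
    obtain ⟨X, -⟩ := P.choice_rules
    exact ⟨.var X, trivial, fun a ha => absurd ha (Finset.notMem_empty a)⟩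
  | insert a se _ ih =>
    obtain ⟨e₁, ht₁, hc₁⟩ := h a (Finset.mem_insert_self _ _)
    obtain ⟨e₂, ht₂, hc₂⟩ := ih fun b hb => h b (Finset.mem_insert_of_mem hb)
    obtain ⟨hr₁, hr₂⟩ := Rewrites.choice P ht₁ ht₂
    refine ⟨.app (.inr S.choice) ![e₁, e₂], Fin.forall_fin_two.2 ⟨ht₁, ht₂⟩, ?_⟩
    exact Finset.forall_mem_insert _ _ _ |>.2 ⟨hc₁.of_rewrites hr₁, hc₂.of_rewrites hr₂⟩

theorem exists_isTotal_coversElem (P : Program S V) (a : ESExp S V) :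
    ∃ e : PExp S V, e.IsTotal ∧ CoversElem P e a := by
  induction a using ESExp.induction with
  | hvar X => exact ⟨.var X, trivial, .var X .refl⟩
  | happ h args ih =>
    choose es htotal hcovers using fun i => exists_isTotal_covers_of_forall_mem (ih i)
    exact ⟨.app h es, htotal, .app h es args .refl hcovers⟩

theorem SCSubst.exists_covers (P : Program S V) (θ : SCSubst S V) :
    ∃ σ : Subst S V, σ.Covers P θ.toFun := by
  classical
  choose g htotal hcovers using fun X =>
    exists_isTotal_covers_of_forall_mem fun a (_ : a ∈ θ.toFun X) => exists_isTotal_coversElem P a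
  let σ : Subst S V :=
    { toFun X := if θ.toFun X = {.var X} then .var X else g X
      total X := by
        split_ifs
        exacts [trivial, htotal X]
      finite_dom := θ.finite_dom.subset fun X hX h => hX (if_pos h) }
  refine ⟨σ, fun X => ?_⟩
  by_cases h : θ.toFun X = {.var X}
  · rw [show σ.toFun X = .var X from if_pos h, h]
    exact covers_toSExp (.var X)
  · rw [show σ.toFun X = g X from if_neg h]
    exact hcovers X

/-- Left-linearity is what allows the matches of the arguments to be glued together. -/
theorem exists_match_args {n : ℕ} {h : S.Sym n} {ps es : Fin n → PExp S V}
    (hlin : (PExp.app h ps).IsLinear) (θ : SCSubst S V)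
    (H : ∀ i, ∃ σ : Subst S V, σ.Covers P θ.toFun ∧ Rewrites P (es i) ((ps i).subst σ.toFun)) :
    ∃ σ : Subst S V, σ.Covers P θ.toFun ∧ ∀ i, Rewrites P (es i) ((ps i).subst σ.toFun) := by
  classical
  choose σ hcovers hrewrites using H
  obtain ⟨σ₀, hcovers₀⟩ := θ.exists_covers P
  let κ : V → Option (Fin n) := fun X => if hX : ∃ i, X ∈ (ps i).vars then some hX.choose else none
  have hκ : ∀ i, ∀ X ∈ (ps i).vars, κ X = some i := fun i X hi => by
    have hX : ∃ i, X ∈ (ps i).vars := ⟨i, hi⟩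
    rw [← hlin.eq_of_mem_vars hX.choose_spec hi]
    exact dif_pos hX
  refine ⟨Subst.glue (fun k => k.elim σ₀ σ) κ, fun X => ?_, fun i => ?_⟩
  · change Covers P ((κ X).elim σ₀ σ |>.toFun X) _
    cases κ X with
    | none => exact hcovers₀ X
    | some i => exact hcovers i X
  · have h_eq : Set.EqOn (Subst.glue (fun k => k.elim σ₀ σ) κ).toFun (σ i).toFun (ps i).vars :=
      fun X hX => by simp only [Subst.glue, hκ i X hX, Option.elim]
    rw [PExp.subst_congr h_eq]
    exact hrewrites i

theorem Covers.exists_match {p : PExp S V} (hc : p.IsCTerm) (ht : p.IsTotal) (hlin : p.IsLinear)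
    {θ : SCSubst S V} {e : PExp S V} (he : e.IsTotal) (H : Covers P e (p.toSExp.subst θ.toFun)) :
    ∃ σ : Subst S V, σ.Covers P θ.toFun ∧ Rewrites P e (p.subst σ.toFun) := by
  induction p generalizing e with
  | bot => exact ht.elim
  | var X =>
    rw [PExp.toSExp_var_subst] at H
    obtain ⟨σ, hσ⟩ := θ.exists_covers P
    refine ⟨σ.update X he, hσ.update he H, ?_⟩
    rw [PExp.subst, Subst.update_self]
    exact .refl
  | app f ps ih =>
    rcases f with c | f
    · rw [PExp.toSExp_app_subst, covers_singleton, coversElem_app] at H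
      obtain ⟨es, hes, hcovers⟩ := H
      have hes_total := hes.isTotal he
      obtain ⟨σ, hσ, hrewrites⟩ := exists_match_args hlin θ fun i =>
        ih i (hc i) (ht i) (hlin.arg i) (hes_total i) (hcovers i)
      exact ⟨σ, hσ, hes.trans (Rewrites.app _ hes_total hrewrites)⟩
    · exact hc.elim

theorem exists_rewrites_covers_rhs {R : Rule S V} (hR : R ∈ P.rules) (θ : SCSubst S V)
    {es : Fin R.arity → PExp S V} (hes : ∀ i, (es i).IsTotal)
    (H : ∀ i, Covers P (es i) ((R.pats i).toSExp.subst θ.toFun)) :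
    ∃ e : PExp S V, Rewrites P (.app (.inr R.head) es) e ∧
      Covers P e (R.rhs.toSExp.subst θ.toFun) := by
  have hrule := P.isCRule R hR
  have hlin : R.lhs.IsLinear := hrule.linear
  obtain ⟨σ, hσ, hmatch⟩ := exists_match_args hlin θ fun i =>
    (H i).exists_match (hrule.pats_cterm i) (hrule.pats_total i) (hlin.arg i) (hes i)
  exact ⟨_, (Rewrites.app _ hes hmatch).trans (Rewrites.of_rule hR σ), hσ.subst R.rhs⟩

theorem Derives.covers {se st : SExp S V} (H : Derives P se st) {e : PExp S V} (he : e.IsTotal)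
    (hse : Covers P e se) : Covers P e st := by
  induction H generalizing e with
  | E => exact fun a ha => absurd ha (Finset.notMem_empty a)
  | RR => exact hse
  | DC c se st _ ih =>
    obtain ⟨es, hes, hcovers⟩ := coversElem_app.1 (covers_singleton.1 hse)
    exact covers_singleton.2
      (coversElem_app.2 ⟨es, hes, fun i => ih i (hes.isTotal he i) (hcovers i)⟩)
  | More se st _ ih => exact covers_biUnion.2 fun i _ => ih i he hse
  | Less se esa st _ _ hmem _ ih =>
    exact covers_biUnion.2 fun i _ => ih i he (covers_singleton.2 (hse _ (hmem i)))
  | ROR R θ se st hR _ _ ih_args ih_rhs =>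
    obtain ⟨es, hes, hcovers⟩ := coversElem_app.1 (covers_singleton.1 hse)
    have hes_total := hes.isTotal he
    obtain ⟨e', he', hrhs⟩ :=
      exists_rewrites_covers_rhs hR θ hes_total fun i => ih_args i (hes_total i) (hcovers i)
    have h : Rewrites P _ e' := hes.trans he'
    exact (ih_rhs (h.isTotal he) hrhs).of_rewrites h

theorem Covers.exists_approx_shell_of_forall_mem {st : SExp S V} {e t : PExp S V}
    (H : ∀ a ∈ st, CoversElem P e a → t ∈ a.flat →
      ∃ e' : PExp S V, Rewrites P e e' ∧ Approx t e'.shell)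
    (he : Covers P e st) (ht : t ∈ st.flat) :
    ∃ e' : PExp S V, Rewrites P e e' ∧ Approx t e'.shell := by
  rcases st.eq_empty_or_nonempty with rfl | hne
  · obtain rfl : t = .bot := by simpa [SExp.flat_empty] using ht
    exact ⟨e, .refl, .bot _⟩
  · rw [SExp.flat_of_nonempty hne] at ht
    obtain ⟨a, ha, hta⟩ := Set.mem_iUnion₂.1 ht
    exact H a ha (he a ha) hta

theorem CoversElem.exists_approx_shell {a : ESExp S V} (ha : a.IsESCTerm) {e t : PExp S V}
    (he : e.IsTotal) (H : CoversElem P e a) (ht : t ∈ a.flat) :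
    ∃ e' : PExp S V, Rewrites P e e' ∧ Approx t e'.shell := by
  induction ha generalizing e t with
  | var X =>
    obtain rfl : t = .var X := by simpa [ESExp.flat_var] using ht
    exact ⟨_, coversElem_var.1 H, .refl _⟩
  | con c args _ ih =>
    rw [ESExp.flat_app] at ht
    obtain ⟨ts, rfl, hts⟩ := ht
    obtain ⟨es, hes, hcovers⟩ := coversElem_app.1 H
    have hes_total := hes.isTotal he
    choose es' hes' happrox using fun i => (hcovers i).exists_approx_shell_of_forall_mem
      (fun a ha h ht => ih i a ha (hes_total i) h ht) (hts i)
    exact ⟨.app (.inl c) es', hes.trans (Rewrites.app _ hes_total hes'), .app _ happrox⟩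

theorem exists_rewrites_of_mem_den {e t : PExp S V} {st : SExp S V} (he : e.IsTotal)
    (hst : st ∈ den P e.toSExp) (ht : t ∈ st.flat) :
    ∃ e' : PExp S V, e'.IsTotal ∧ Rewrites P e e' ∧ Approx t e'.shell := by
  obtain ⟨hsc, hder⟩ := hst
  obtain ⟨e', hrewrites, happrox⟩ :=
    (hder.covers he (covers_toSExp e)).exists_approx_shell_of_forall_mem
      (fun a ha h ht => h.exists_approx_shell (hsc a ha) he ht) ht
  exact ⟨e', hrewrites.isTotal he, hrewrites, happrox⟩

/-! ### The structural rules of the calculus -/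

theorem Derives.of_mem {a : ESExp S V} {se st : SExp S V} (H : Derives P {a} st) (ha : a ∈ se) :
    Derives P se st := by
  rcases lt_or_ge 1 se.card with hcard | hcard
  · simpa using Derives.Less (m := 1) se (fun _ => a) (fun _ => st) hcard one_pos (fun _ => ha)
      fun _ => H
  · have hse : se = {a} := Finset.eq_singleton_iff_unique_mem.2
      ⟨ha, fun b hb => Finset.card_le_one.1 hcard b hb a ha⟩
    rwa [hse]

theorem Derives.of_forall_mem {se st : SExp S V} (h : ∀ a ∈ st, Derives P se {a}) :
    Derives P se st := by
  have hst : st = Finset.univ.biUnion fun j => {(st.equivFin.symm j).1} := by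
    ext a
    simp [st.equivFin.symm.exists_congr_left]
  rw [hst]
  exact .More se _ fun j => h _ (st.equivFin.symm j).2

theorem Derives.exists_mem {se st : SExp S V} (H : Derives P se st) {a : ESExp S V} (ha : a ∈ st) :
    ∃ b ∈ se, Derives P {b} {a} := by
  induction H with
  | E => exact absurd ha (Finset.notMem_empty a)
  | RR X =>
    obtain rfl := Finset.mem_singleton.1 ha
    exact ⟨_, ha, .RR X⟩
  | DC c se st h =>
    obtain rfl := Finset.mem_singleton.1 ha
    exact ⟨_, Finset.mem_singleton_self _, .DC c se st h⟩
  | More se st _ ih =>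
    obtain ⟨i, -, ha⟩ := Finset.mem_biUnion.1 ha
    exact ih i ha
  | Less se esa st _ _ hmem _ ih =>
    obtain ⟨i, -, ha⟩ := Finset.mem_biUnion.1 ha
    obtain ⟨b, hb, hba⟩ := ih i ha
    exact ⟨esa i, hmem i, Finset.mem_singleton.1 hb ▸ hba⟩
  | ROR R θ se st hR hargs _ _ ih =>
    obtain ⟨b, hb, hba⟩ := ih ha
    exact ⟨_, Finset.mem_singleton_self _, .ROR R θ se _ hR hargs (hba.of_mem hb)⟩

theorem derives_iff_forall_exists_mem {se st : SExp S V} :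
    Derives P se st ↔ ∀ a ∈ st, ∃ b ∈ se, Derives P {b} {a} := by
  refine ⟨fun H a => H.exists_mem, fun H => .of_forall_mem fun a ha => ?_⟩
  obtain ⟨b, hb, hba⟩ := H a ha
  exact hba.of_mem hb

theorem Derives.mono {se se' st st' : SExp S V} (H : Derives P se st) (hse : se ⊆ se')
    (hst : st' ⊆ st) : Derives P se' st' :=
  derives_iff_forall_exists_mem.2 fun _ ha =>
    let ⟨b, hb, hba⟩ := H.exists_mem (hst ha)
    ⟨b, hse hb, hba⟩

theorem Derives.biUnion {ι : Type*} {s : Finset ι} {se : SExp S V} {st : ι → SExp S V}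
    (H : ∀ i ∈ s, Derives P se (st i)) : Derives P se (s.biUnion st) :=
  derives_iff_forall_exists_mem.2 fun _ ha =>
    let ⟨i, hi, ha⟩ := Finset.mem_biUnion.1 ha
    (H i hi).exists_mem ha

theorem Derives.isSCTerm {se st : SExp S V} (H : Derives P se st) : st.IsSCTerm := by
  induction H with
  | E => exact fun a ha => absurd ha (Finset.notMem_empty a)
  | RR X => exact SExp.isSCTerm_singleton.2 (.var X)
  | DC c _ st _ ih => exact SExp.isSCTerm_singleton.2 (.con c st ih)
  | More _ _ _ ih => exact .biUnion fun i _ => ih i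
  | Less _ _ _ _ _ _ _ ih => exact .biUnion fun i _ => ih i
  | ROR _ _ _ _ _ _ _ _ ih => exact ih

theorem Derives.refl_singleton {a : ESExp S V} (ha : a.IsESCTerm) : Derives P {a} {a} := by
  induction ha with
  | var X => exact .RR X
  | con c args _ ih =>
    exact .DC c _ _ fun i => derives_iff_forall_exists_mem.2 fun a ha => ⟨a, ha, ih i a ha⟩

theorem Derives.refl {st : SExp S V} (h : st.IsSCTerm) : Derives P st st :=
  derives_iff_forall_exists_mem.2 fun a ha => ⟨a, ha, .refl_singleton (h a ha)⟩

theorem Derives.subset_of_var {X : V} {st : SExp S V} (H : Derives P {.var X} st) :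
    st ⊆ {.var X} := by
  generalize hx : ({.var X} : SExp S V) = x at H ⊢
  induction H with
  | E => exact Finset.empty_subset _
  | RR => exact subset_rfl
  | DC => exact absurd (Finset.singleton_injective hx) (ESExp.var_ne_app _ _ _)
  | More _ _ _ ih => exact Finset.biUnion_subset.2 fun i _ => ih i hx
  | Less _ _ _ hcard => simp [← hx] at hcard
  | ROR => exact absurd (Finset.singleton_injective hx) (ESExp.var_ne_app _ _ _)

/-- `{h(ts)}` derives `{a}` by (DC) or (ROR), with `ts` exactly what the rule asks the arguments to
derive. It isolates the part of a derivation from `{h(se₁, …, seₙ)}` that does not depend on the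
`seᵢ`. -/
inductive RootDerives (P : Program S V) :
    ∀ {n : ℕ}, S.Sym n → (Fin n → SExp S V) → ESExp S V → Prop
  | con {n : ℕ} (c : S.Con n) (ts : Fin n → SExp S V) :
      RootDerives P (.inl c) ts (.app (.inl c) ts)
  | rule (R : Rule S V) (θ : SCSubst S V) (a : ESExp S V) :
      R ∈ P.rules → Derives P (R.rhs.toSExp.subst θ.toFun) {a} →
      RootDerives P (.inr R.head) (fun i => (R.pats i).toSExp.subst θ.toFun) a

theorem Derives.exists_rootDerives {n : ℕ} {h : S.Sym n} {se : Fin n → SExp S V} {st : SExp S V}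
    (H : Derives P {.app h se} st) {a : ESExp S V} (ha : a ∈ st) :
    ∃ ts, (∀ i, Derives P (se i) (ts i)) ∧ RootDerives P h ts a := by
  generalize hx : ({.app h se} : SExp S V) = x at H
  induction H with
  | E => exact absurd ha (Finset.notMem_empty a)
  | RR => exact absurd (Finset.singleton_injective hx).symm (ESExp.var_ne_app _ _ _)
  | DC c _ ts hargs =>
    have hx := Finset.singleton_injective hx
    obtain rfl := ESExp.app_inj_arity hx
    obtain ⟨rfl, rfl⟩ := ESExp.app_inj hx
    obtain rfl := Finset.mem_singleton.1 ha
    exact ⟨ts, hargs, .con c ts⟩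
  | More _ _ _ ih =>
    obtain ⟨i, -, ha⟩ := Finset.mem_biUnion.1 ha
    exact ih i ha hx
  | Less _ _ _ hcard => simp [← hx] at hcard
  | ROR R θ _ _ hR hargs hrhs =>
    have hx := Finset.singleton_injective hx
    obtain rfl := ESExp.app_inj_arity hx
    obtain ⟨rfl, rfl⟩ := ESExp.app_inj hx
    exact ⟨_, hargs, .rule R θ a hR (hrhs.mono subset_rfl (Finset.singleton_subset_iff.2 ha))⟩

theorem RootDerives.derives {n : ℕ} {h : S.Sym n} {se ts : Fin n → SExp S V} {a : ESExp S V}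
    (H : RootDerives P h ts a) (hargs : ∀ i, Derives P (se i) (ts i)) :
    Derives P {.app h se} {a} := by
  cases H with
  | con c => exact .DC c se ts hargs
  | rule R θ _ hR hrhs => exact .ROR R θ se {a} hR hargs hrhs

theorem Derives.app_mono {n : ℕ} {h : S.Sym n} {se se' : Fin n → SExp S V}
    (hse : ∀ i st, Derives P (se i) st → Derives P (se' i) st) {st : SExp S V}
    (H : Derives P {.app h se} st) : Derives P {.app h se'} st :=
  .of_forall_mem fun _ ha =>
    let ⟨_, hargs, hroot⟩ := H.exists_rootDerives ha
    hroot.derives fun i => hse i _ (hargs i)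

/-! ### Completeness -/

theorem Derives.subst_mono {θ θ' : V → SExp S V} (hθ : ∀ X, θ X ⊆ θ' X) (e : PExp S V)
    {st : SExp S V} (H : Derives P (e.toSExp.subst θ) st) : Derives P (e.toSExp.subst θ') st := by
  induction e generalizing st with
  | bot => exact H
  | var X =>
    rw [PExp.toSExp_var_subst] at H ⊢
    exact H.mono (hθ X) subset_rfl
  | app h args ih =>
    rw [PExp.toSExp_app_subst] at H ⊢
    exact H.app_mono fun i _ => ih i

theorem Derives.exists_subst {σ : V → SExp S V} (e : PExp S V) {st : SExp S V}
    (H : Derives P (e.toSExp.subst σ) st) :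
    ∃ θ : V → SExp S V, (∀ X, Derives P (σ X) (θ X)) ∧ Derives P (e.toSExp.subst θ) st := by
  classical
  induction e generalizing st with
  | bot => exact ⟨fun _ => ∅, fun _ => .E _, H⟩
  | var X =>
    rw [PExp.toSExp_var_subst] at H
    refine ⟨Function.update (fun _ => ∅) X st, ?_, ?_⟩
    · exact Function.forall_update_iff _ (fun Y t => Derives P (σ Y) t) |>.2 ⟨H, fun _ _ => .E _⟩
    · rw [PExp.toSExp_var_subst, Function.update_self]
      exact .refl H.isSCTerm
  | app h args ih =>
    rw [PExp.toSExp_app_subst] at H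
    choose! ts hts hroot using fun a (ha : a ∈ st) => H.exists_rootDerives ha
    choose! θ hσ hθ using fun a (ha : a ∈ st) i => ih i (hts a ha i)
    refine ⟨fun X => st.biUnion fun a => Finset.univ.biUnion fun i => θ a i X,
      fun X => .biUnion fun a ha => .biUnion fun i _ => hσ a ha i X, .of_forall_mem fun a ha => ?_⟩
    rw [PExp.toSExp_app_subst]
    refine (hroot a ha).derives fun i => (hθ a ha i).subst_mono fun X => ?_
    exact (Finset.subset_biUnion_of_mem (θ a · X) (Finset.mem_univ i)).trans
      (Finset.subset_biUnion_of_mem (fun a => Finset.univ.biUnion (θ a · X)) ha)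

theorem PExp.IsCTerm.derives_subst {p : PExp S V} (hp : p.IsCTerm) {σ θ : V → SExp S V}
    (h : ∀ X, Derives P (σ X) (θ X)) : Derives P (p.toSExp.subst σ) (p.toSExp.subst θ) := by
  induction p with
  | bot => exact .E _
  | var X =>
    simp only [PExp.toSExp_var_subst]
    exact h X
  | app f args ih =>
    rcases f with c | f
    · simp only [PExp.toSExp_app_subst]
      exact .DC c _ _ fun i => ih i (hp i)
    · exact hp.elim

theorem Subst.exists_scSubst (σ : Subst S V) {e : PExp S V} {st : SExp S V}
    (H : Derives P (e.subst σ.toFun).toSExp st) :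
    ∃ θ : SCSubst S V, (∀ X, Derives P (σ.toFun X).toSExp (θ.toFun X)) ∧
      Derives P (e.toSExp.subst θ.toFun) st := by
  classical
  rw [PExp.toSExp_subst] at H
  obtain ⟨θ, hθ, hst⟩ := H.exists_subst
  -- `θ` may be `∅` outside the domain of `σ`; resetting it to `{X}` there makes its domain finite.
  let τ : V → SExp S V := fun X => if σ.toFun X = .var X then {.var X} else θ X
  have hτ : ∀ X, Derives P (σ.toFun X).toSExp (τ X) ∧ θ X ⊆ τ X := fun X => by
    by_cases hX : σ.toFun X = .var X
    · have hder := hθ X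
      rw [hX] at hder
      simpa only [τ, if_pos hX, hX] using And.intro (.RR X) hder.subset_of_var
    · simpa only [τ, if_neg hX] using And.intro (hθ X) subset_rfl
  refine ⟨⟨τ, fun X => (hτ X).1.isSCTerm, ?_⟩, fun X => (hτ X).1, hst.subst_mono fun X => (hτ X).2⟩
  exact σ.finite_dom.subset fun X hX h => hX (if_pos h)

theorem Derives.of_rule {R : Rule S V} (hR : R ∈ P.rules) (σ : Subst S V) {st : SExp S V}
    (H : Derives P (R.rhs.subst σ.toFun).toSExp st) :
    Derives P (R.lhs.subst σ.toFun).toSExp st := by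
  obtain ⟨θ, hθ, hst⟩ := σ.exists_scSubst H
  rw [PExp.toSExp_subst, Rule.lhs, PExp.toSExp_app_subst]
  exact .ROR R θ _ _ hR (fun i => ((P.isCRule R hR).pats_cterm i).derives_subst hθ) hst

theorem Derives.fill {e e' : PExp S V} (h : ∀ st, Derives P e'.toSExp st → Derives P e.toSExp st)
    (C : Ctx S V) {st : SExp S V} (H : Derives P (C.fill e').toSExp st) :
    Derives P (C.fill e).toSExp st := by
  induction C generalizing st with
  | hole => exact h st H
  | app f i es C ih =>
    refine H.app_mono fun j st' hj => ?_
    by_cases hji : j = i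
    · subst hji
      rw [Function.update_self] at hj ⊢
      exact ih hj
    · rwa [Function.update_of_ne hji] at hj ⊢

theorem Derives.of_rewrites {e e' : PExp S V} (h : Rewrites P e e') {st : SExp S V}
    (H : Derives P e'.toSExp st) : Derives P e.toSExp st := by
  induction h with
  | refl => exact H
  | tail _ hstep ih =>
    obtain ⟨C, R, σ, -, hR, rfl, rfl⟩ := hstep
    exact ih (H.fill (fun _ => .of_rule hR σ) C)

theorem derives_toSExp_shell (e : PExp S V) : Derives P e.toSExp e.shell.toSExp := by
  induction e with
  | bot => exact .E _
  | var X => exact .RR X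
  | app f args ih =>
    rcases f with c | f
    · exact .DC c _ _ ih
    · exact .E _

theorem Rewrites.shell_mem_den {e e' : PExp S V} (h : Rewrites P e e') :
    e'.shell.toSExp ∈ den P e.toSExp :=
  have hder := (derives_toSExp_shell e').of_rewrites h
  ⟨hder.isSCTerm, hder⟩

end SCalc

theorem mainTheorem2 {S : Signature.{u}} {V : Type u} (P : Program S V) :
    -- Soundness
    (∀ e t : PExp S V, ∀ st : SExp S V, e.IsTotal → t.IsCTerm → st.IsSCTerm →
      (st ∈ den P e.toSExp → t ∈ st.flat →
        ∃ e' : PExp S V, e'.IsTotal ∧ Rewrites P e e' ∧ Approx t e'.shell) ∧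
      (t.toSExp ∈ den P e.toSExp →
        ∃ e' : PExp S V, e'.IsTotal ∧ Rewrites P e e' ∧ Approx t e'.shell) ∧
      (t.IsTotal → ((st ∈ den P e.toSExp ∧ t ∈ st.flat) ∨ t.toSExp ∈ den P e.toSExp) →
        Rewrites P e t)) ∧
    -- Completeness
    (∀ e e' : PExp S V, e.IsTotal → e'.IsTotal → Rewrites P e e' →
      e'.shell.toSExp ∈ den P e.toSExp) ∧
    (∀ e t : PExp S V, e.IsTotal → t.IsCTerm → t.IsTotal → Rewrites P e t →
      t.toSExp ∈ den P e.toSExp) := by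
  refine ⟨fun e t st he _ _ => ?_, fun _ _ _ _ h => h.shell_mem_den,
    fun _ _ _ ht _ h => ht.shell_eq ▸ h.shell_mem_den⟩
  have of_flat := fun hst => exists_rewrites_of_mem_den (P := P) (t := t) (st := st) he hst
  have of_toSExp := fun ht => exists_rewrites_of_mem_den (P := P) he ht t.mem_flat_toSExp
  refine ⟨of_flat, of_toSExp, fun htotal h => ?_⟩
  obtain ⟨e', -, hrewrites, happrox⟩ := h.elim (fun h => of_flat h.1 h.2) of_toSExp
  rwa [happrox.eq_of_isTotal_of_shell htotal]
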